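/- **Setting.** A *weighted set* is a finite set $I$ of items with weights $w_i>0$ for $i\in I$ (and $w_i=0$ for $i\notin I$). A *sampling scheme* for $I$ is a discrete probability distribution over weighted sets $(S,\hat w)$ with $S\subseteq I$; $S$ is the sample, $\hat w_i>0$ is the weight estimate of a sampled item $i\in S$, and $\hat w_i=0$ for $i\notin S$. For an integer $k\ge 1$ the *threshold* $\tau_k$ of $I$ is the unique $\tau>0$ with $\sum_{i\in I}\min\{1,w_i/\tau\}=k$ if $k<|I|$, and $\tau_k=0$ if $k\ge|I|$. Consider the following properties of a scheme. * *Unbiased:* $\mathrm{E}[\hat w_i]=w_i$ for all $i\in I$. * (i) *(ipps)* $\Pr[i\in S]=\min\{1,w_i/\tau_k\}$ for all $i\in I$ (read as $1$ if $\tau_k=0$), and each sampled item $i\in S$ gets the estimate $\hat w_i=\max\{w_i,\tau_k\}$. * (ii) $|S|\le k$. * (iii) $\mathrm{Cov}[\hat w_i,\hat w_j]$ exists and is $\le 0$ for all distinct $i,j\in I$. * (iii+) For every $J\subseteq I$, $\Pr[J\subseteq S]\le\prod_{i\in J}\Pr[i\in S]$ and $\Pr[J\cap S=\emptyset]\le\prod_{i\in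 J}\Pr[i\notin S]$. A *VarOpt$_k$ scheme* is an unbiased scheme that satisfies (i), (ii) and (iii) for $k$. Let $I_1,\dots,I_m$ be disjoint weighted sets and let $k\ge1$ and $k_1,\dots,k_m\ge k$ be integers. For each $x$ let a scheme for $I_x$ be given (the *inner subcalls*), and for every weighted set $v$ a scheme for $v$ (the *outer subcall* on input $v$). The *resulting call* is the following scheme for $I=\bigcup_x I_x$: run the inner subcalls independently of each other, let $I'$ be the union of their samples, weighted by their estimates, and, with independent random choices, run the outer subcall on $I'$, treating the estimates as weights; its sample and its estimates are the result. **Theorem.** Below, "the outer subcall has a property" means that it has this property on every input $I'$ that the inner subcalls produce with positive probability. 1. If all the subcalls are unbiased, then the resulting call is unbiased. 2. If all the subcalls are unbiased and satisfy (iii), then the resulting call satisfies (iii). 3. If each inner subcall satisfies (i) and (ii) with $k_x$ in place of $k$, and the outer subcall satisfies (i) for $k$, then the resulting call satisfies (i) for $k$. 4. If each inner subcall is a VarOpt$_{k_x}$ scheme and the outer subcall is a VarOpt$_k$ scheme, then the resulting call is a VarOpt$_k$ scheme. 5. If, in addition to the assumptions of 4, all the subcalls satisfy (iii+), then the resulting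 call is a VarOpt$_k$ scheme that satisfies (iii+). -/

import Mathlib

open MeasureTheory ProbabilityTheory

noncomputable section

namespace VarOpt

/-- A finite set of items, each with a positive weight. An item outside the set has the implicit
weight `0`. -/
@[ext]
structure WeightedSet (ι : Type*) where
  items : Finset ι
  weight : ι → ℝ
  weight_pos : ∀ i ∈ items, 0 < weight i
  weight_eq_zero : ∀ i, i ∉ items → weight i = 0

/-- All sets of weighted sets are events. -/
instance WeightedSet.instMeasurableSpace (ι : Type*) : MeasurableSpace (WeightedSet ι) := ⊤

theorem WeightedSet.weight_nonneg {ι : Type*} (I : WeightedSet ι) (i : ι) : 0 ≤ I.weight i := by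
  by_cases h : i ∈ I.items
  · exact (I.weight_pos i h).le
  · exact (I.weight_eq_zero i h).ge

/-- The union of a finite family of weighted sets. When the item sets are disjoint (the only case
that occurs below) every item keeps the weight that it has in the member containing it, because
all the other summands are `0`. -/
def WeightedSet.union {ι : Type*} [DecidableEq ι] {m : ℕ} (I : Fin m → WeightedSet ι) :
    WeightedSet ι where
  items := Finset.univ.biUnion fun x => (I x).items
  weight i := ∑ x, (I x).weight i
  weight_pos := by
    intro i hi
    obtain ⟨x, -, hx⟩ := Finset.mem_biUnion.mp hi
    exact Finset.sum_pos' (fun y _ => (I y).weight_nonneg i)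
      ⟨x, Finset.mem_univ x, (I x).weight_pos i hx⟩
  weight_eq_zero := by
    intro i hi
    refine Finset.sum_eq_zero fun x _ => (I x).weight_eq_zero i fun hx => hi ?_
    exact Finset.mem_biUnion.mpr ⟨x, Finset.mem_univ x, hx⟩

/-- A sampling and estimation scheme for the input `I`: a probability distribution over outcomes
`o`, where `o.items ⊆ I.items` is the sample and `o.weight i` is the weight estimate (adjusted
weight) of item `i`, which is `0` if `i` is not sampled. -/
structure Scheme {ι : Type*} (I : WeightedSet ι) where
  law : PMF (WeightedSet ι)
  subset : ∀ o ∈ law.support, o.items ⊆ I.items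

/-- `τ` is the threshold of `I` for capacity `k`. -/
def IsThreshold {ι : Type*} (k : ℕ) (I : WeightedSet ι) (τ : ℝ) : Prop :=
  (k < I.items.card ∧ 0 < τ ∧ ∑ i ∈ I.items, min 1 (I.weight i / τ) = k) ∨
    (I.items.card ≤ k ∧ τ = 0)

/-- The threshold probability `min {1, w / τ}`, which is `1` for `τ = 0`. -/
def thresholdProb (w τ : ℝ) : ℝ := if τ = 0 then 1 else min 1 (w / τ)

namespace Scheme

variable {ι : Type*} {I : WeightedSet ι}

/-- The probability that all the items of `J` are sampled. -/
def inclProb (A : Scheme I) (J : Finset ι) : ℝ := A.law.toMeasure.real {o | J ⊆ o.items}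

/-- The probability that none of the items of `J` is sampled. -/
def exclProb (A : Scheme I) (J : Finset ι) : ℝ := A.law.toMeasure.real {o | Disjoint J o.items}

/-- The weight estimates are unbiased. -/
def Unbiased (A : Scheme I) : Prop :=
  ∀ i ∈ I.items, Integrable (fun o => o.weight i) A.law.toMeasure ∧
    ∫ o, o.weight i ∂A.law.toMeasure = I.weight i

/-- (i): ipps threshold probabilities with Horvitz-Thompson estimates. -/
def Ipps (k : ℕ) (A : Scheme I) : Prop :=
  ∃ τ, IsThreshold k I τ ∧
    (∀ i ∈ I.items, A.inclProb {i} = thresholdProb (I.weight i) τ) ∧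
    ∀ o ∈ A.law.support, ∀ i ∈ o.items, o.weight i = max (I.weight i) τ

/-- (ii): at most `k` samples. -/
def AtMost (k : ℕ) (A : Scheme I) : Prop := ∀ o ∈ A.law.support, o.items.card ≤ k

/-- (iii): the covariances of distinct weight estimates exist and are not positive. -/
def NonposCov (A : Scheme I) : Prop :=
  ∀ i ∈ I.items, ∀ j ∈ I.items, i ≠ j →
    Integrable (fun o => o.weight i) A.law.toMeasure ∧
    Integrable (fun o => o.weight j) A.law.toMeasure ∧
    Integrable (fun o => o.weight i * o.weight j) A.law.toMeasure ∧
    cov[fun o => o.weight i, fun o => o.weight j; A.law.toMeasure] ≤ 0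

/-- (iii+): joint inclusion and exclusion probabilities are at most the products of the
marginals. -/
def HighOrder (A : Scheme I) : Prop :=
  ∀ J ⊆ I.items, A.inclProb J ≤ ∏ i ∈ J, A.inclProb {i} ∧
    A.exclProb J ≤ ∏ i ∈ J, A.exclProb {i}

/-- A `VarOpt_k` scheme: unbiased with (i), (ii) and (iii). -/
structure IsVarOpt (k : ℕ) (A : Scheme I) : Prop where
  unbiased : A.Unbiased
  ipps : A.Ipps k
  atMost : A.AtMost k
  nonposCov : A.NonposCov

/-- A `VarOpt_k` scheme with (iii+) in addition. -/
structure IsVarOptPlus (k : ℕ) (A : Scheme I) : Prop extends A.IsVarOpt k where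
  highOrder : A.HighOrder

end Scheme

theorem tsum_prod_eq_one {α : Type*} : ∀ {m : ℕ} (p : Fin m → PMF α),
    ∑' f : Fin m → α, ∏ x, p x (f x) = 1
  | 0, p => by simp
  | m + 1, p => by
    rw [← (Fin.consEquiv fun _ : Fin (m + 1) => α).tsum_eq, ENNReal.tsum_prod']
    simp [Fin.consEquiv, Fin.prod_univ_succ, ENNReal.tsum_mul_left,
      tsum_prod_eq_one fun x : Fin m => p x.succ, PMF.tsum_coe]

/-- The joint distribution of independent draws from `p 0, …, p (m - 1)`. -/
def indep {α : Type*} {m : ℕ} (p : Fin m → PMF α) : PMF (Fin m → α) :=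
  ⟨fun f => ∏ x, p x (f x), by
    have h := ENNReal.summable.hasSum (f := fun f : Fin m → α => ∏ x, p x (f x))
    rwa [tsum_prod_eq_one] at h⟩

section Recurrence

variable {ι : Type*} [DecidableEq ι] {m : ℕ} {I : Fin m → WeightedSet ι}

/-- The combined inner sampling: run the schemes `inner x` independently of each other and take
the union of the resulting samples with their adjusted weights. -/
def innerUnion (inner : ∀ x, Scheme (I x)) : Scheme (WeightedSet.union I) where
  law := (indep fun x => (inner x).law).map WeightedSet.union
  subset := by
    intro o ho
    obtain ⟨f, hf, rfl⟩ := (PMF.mem_support_map_iff _ _ _).mp ho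
    have hx : ∀ x, f x ∈ (inner x).law.support := fun x h0 =>
      hf (Finset.prod_eq_zero (Finset.mem_univ x) h0)
    exact Finset.biUnion_mono fun x _ => (inner x).subset (f x) (hx x)

/-- The resulting call: run the combined inner sampling, and then, with fresh randomness, the
outer scheme on its outcome, treating the adjusted weights as if they were original weights. -/
def resulting (inner : ∀ x, Scheme (I x)) (outer : ∀ v : WeightedSet ι, Scheme v) :
    Scheme (WeightedSet.union I) where
  law := (innerUnion inner).law.bind fun v => (outer v).law
  subset := by
    intro o ho
    obtain ⟨v, hv, hov⟩ := (PMF.mem_support_bind_iff _ _ _).mp ho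
    exact ((outer v).subset o hov).trans ((innerUnion inner).subset v hv)

end Recurrence

end VarOpt

end

open scoped ENNReal

noncomputable section

namespace VarOpt

/-! ### Expectations of nonnegative functions under a probability mass function -/

/-! The resulting call is a composition: the independent union of the inner calls, followed by the
outer call. Unbiasedness passes through by conditioning on the intermediate outcome `v`. For
unbiased estimates, (iii) says that the expected product of two estimates is at most the product of
the weights. Given `v` this product has expectation at most that of the two intermediate weights,
and the first stage bounds the expectation of the latter; there, items of different blocks are
independent.

The heart of (i) is that the outer call effectively uses the threshold `τ` of the whole input,
whatever the inner calls return. If `τ > 0`, each block has threshold sum at most `k ≤ kx x` at `τ`,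
so its own threshold `σ x` is at most `τ`. An inner sample has exactly `kx x` items or is the whole
block, which makes its threshold sum at `τ` equal to that of the block
(`Scheme.IppsAt.thresholdSum_eq`). Every `v` therefore has threshold sum `k` at `τ`. The two
inclusion probabilities multiply to `min 1 (w / τ)`, and `max (max w σ) τ = max w τ`. If `τ = 0`,
nothing is ever dropped.

In consequence, the outer inclusion probability `p i` of an item that reaches the outer call is a
constant. Given this, (iii+) composes (`Scheme.HighOrder.comp`): inclusion by multiplying, exclusion
by expanding a product over subsets. -/

/-- The expectation of a nonnegative function under a probability mass function. -/
def expect {α : Type*} (p : PMF α) (f : α → ℝ≥0∞) : ℝ≥0∞ := ∑' a, p a * f a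

section Expect

variable {α β : Type*}

theorem toMeasure_eq_sum_dirac [MeasurableSpace α] (p : PMF α) :
    p.toMeasure = Measure.sum fun a => p a • Measure.dirac a := by
  ext s hs
  rw [PMF.toMeasure_apply _ hs, Measure.sum_apply _ hs]
  refine tsum_congr fun a => ?_
  by_cases h : a ∈ s <;> simp [Measure.dirac_apply' _ hs, h]

theorem lintegral_toMeasure_eq_expect [MeasurableSpace α] (p : PMF α) {f : α → ℝ≥0∞}
    (hf : Measurable f) : ∫⁻ a, f a ∂p.toMeasure = expect p f := by
  rw [toMeasure_eq_sum_dirac, lintegral_sum_measure]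
  refine tsum_congr fun a => ?_
  rw [lintegral_smul_measure, lintegral_dirac' _ hf, smul_eq_mul]

theorem expect_le_expect (p : PMF α) {f g : α → ℝ≥0∞} (h : ∀ a ∈ p.support, f a ≤ g a) :
    expect p f ≤ expect p g := by
  refine ENNReal.tsum_le_tsum fun a => ?_
  by_cases ha : p a = 0
  · simp [ha]
  · gcongr
    exact h a ha

theorem expect_congr (p : PMF α) {f g : α → ℝ≥0∞} (h : ∀ a ∈ p.support, f a = g a) :
    expect p f = expect p g :=
  le_antisymm (expect_le_expect p fun a ha => (h a ha).le)
    (expect_le_expect p fun a ha => (h a ha).ge)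

theorem expect_const (p : PMF α) (c : ℝ≥0∞) : expect p (fun _ => c) = c := by
  simp [expect, ENNReal.tsum_mul_right, p.tsum_coe]

theorem expect_mul_left (p : PMF α) (c : ℝ≥0∞) (f : α → ℝ≥0∞) :
    expect p (fun a => c * f a) = c * expect p f := by
  simp only [expect, ← ENNReal.tsum_mul_left]
  exact tsum_congr fun a => by ring

theorem expect_add (p : PMF α) (f g : α → ℝ≥0∞) :
    expect p (fun a => f a + g a) = expect p f + expect p g := by
  simp only [expect, mul_add, ENNReal.tsum_add]

theorem expect_finset_sum {κ : Type*} (p : PMF α) (s : Finset κ) (f : κ → α → ℝ≥0∞) :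
    expect p (fun a => ∑ i ∈ s, f i a) = ∑ i ∈ s, expect p (f i) := by
  simp only [expect, Finset.mul_sum]
  exact Summable.tsum_finsetSum fun _ _ => ENNReal.summable

theorem expect_bind (p : PMF α) (q : α → PMF β) (f : β → ℝ≥0∞) :
    expect (p.bind q) f = expect p fun a => expect (q a) f := by
  simp only [expect, PMF.bind_apply, ← ENNReal.tsum_mul_right, ← ENNReal.tsum_mul_left]
  rw [ENNReal.tsum_comm]
  simp only [mul_assoc]

theorem expect_pure (a : α) (f : α → ℝ≥0∞) : expect (PMF.pure a) f = f a := by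
  rw [expect, tsum_eq_single a fun b hb => by simp [PMF.pure_apply, hb]]
  simp

theorem expect_map (p : PMF α) (g : α → β) (f : β → ℝ≥0∞) :
    expect (p.map g) f = expect p fun a => f (g a) := by
  rw [← PMF.bind_pure_comp, expect_bind]
  simp [expect_pure]

theorem expect_eq_zero_iff (p : PMF α) (f : α → ℝ≥0∞) :
    expect p f = 0 ↔ ∀ a ∈ p.support, f a = 0 := by
  simp only [expect, ENNReal.tsum_eq_zero, mul_eq_zero, PMF.mem_support_iff]
  exact forall_congr' fun a => or_iff_not_imp_left

theorem mem_support_indep {m : ℕ} {p : Fin m → PMF α} {f : Fin m → α} :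
    f ∈ (indep p).support ↔ ∀ x, f x ∈ (p x).support := by
  rw [PMF.mem_support_iff]
  change ∏ x, p x (f x) ≠ 0 ↔ _
  simp [Finset.prod_ne_zero_iff]

theorem tsum_prod_eq_prod_tsum : ∀ {m : ℕ} (g : Fin m → α → ℝ≥0∞),
    ∑' f : Fin m → α, ∏ x, g x (f x) = ∏ x, ∑' a, g x a
  | 0, g => by simp
  | m + 1, g => by
    rw [← (Fin.consEquiv fun _ : Fin (m + 1) => α).tsum_eq, ENNReal.tsum_prod']
    simp [Fin.consEquiv, Fin.prod_univ_succ, ENNReal.tsum_mul_left, ENNReal.tsum_mul_right,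
      tsum_prod_eq_prod_tsum fun x : Fin m => g x.succ]

theorem expect_indep_prod {m : ℕ} (p : Fin m → PMF α) (g : Fin m → α → ℝ≥0∞) :
    expect (indep p) (fun f => ∏ x, g x (f x)) = ∏ x, expect (p x) (g x) := by
  simp only [expect, ← tsum_prod_eq_prod_tsum]
  refine tsum_congr fun f => ?_
  rw [Finset.prod_mul_distrib]
  rfl

theorem expect_indep_eval {m : ℕ} (p : Fin m → PMF α) (x : Fin m) (g : α → ℝ≥0∞) :
    expect (indep p) (fun f => g (f x)) = expect (p x) g := by
  have h := expect_indep_prod p fun y a => if y = x then g a else 1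
  simp only [Finset.prod_ite_eq', Finset.mem_univ, if_true] at h
  rw [h, Finset.prod_eq_single x]
  · simp
  · intro y _ hy
    simp [hy, expect_const]
  · simp

theorem expect_indep_eval_mul {m : ℕ} (p : Fin m → PMF α) {x y : Fin m} (hxy : x ≠ y)
    (g h : α → ℝ≥0∞) :
    expect (indep p) (fun f => g (f x) * h (f y)) = expect (p x) g * expect (p y) h := by
  have H := expect_indep_prod p fun z a =>
    (if z = x then g a else 1) * (if z = y then h a else 1)
  simp only [Finset.prod_mul_distrib, Finset.prod_ite_eq', Finset.mem_univ, if_true] at H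
  rw [H, ← Finset.mul_prod_erase _ _ (Finset.mem_univ x),
    ← Finset.mul_prod_erase _ _ (Finset.mem_erase.2 ⟨hxy.symm, Finset.mem_univ y⟩),
    Finset.prod_eq_one, mul_one]
  · simp [hxy, hxy.symm]
  · intro z hz
    simp only [Finset.mem_erase, Finset.mem_univ, and_true] at hz
    simp [hz.1, hz.2, expect_const]

end Expect

/-! ### Properties of schemes in terms of expectations -/

theorem WeightedSet.measurable_of_top {ι β : Type*} [MeasurableSpace β]
    (f : WeightedSet ι → β) : Measurable f := measurable_from_top

/-- The weight of an item as an extended nonnegative real. -/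
def WeightedSet.eweight {ι : Type*} (o : WeightedSet ι) (i : ι) : ℝ≥0∞ :=
  ENNReal.ofReal (o.weight i)

theorem WeightedSet.eweight_eq_zero {ι : Type*} {o : WeightedSet ι} {i : ι} (h : i ∉ o.items) :
    o.eweight i = 0 := by simp [eweight, o.weight_eq_zero i h]

/-- Since the right-hand side is finite, the single equation in `ℝ≥0∞` also carries integrability.
All later arguments can then rearrange sums freely. -/
theorem integrable_and_integral_eq_iff {ι : Type*} (p : PMF (WeightedSet ι))
    (f : WeightedSet ι → ℝ) (hf : ∀ o, 0 ≤ f o) (c : ℝ) (hc : 0 ≤ c) :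
    (Integrable f p.toMeasure ∧ ∫ o, f o ∂p.toMeasure = c) ↔
      expect p (fun o => ENNReal.ofReal (f o)) = ENNReal.ofReal c := by
  have hm := WeightedSet.measurable_of_top f
  rw [← lintegral_toMeasure_eq_expect p (WeightedSet.measurable_of_top _)]
  constructor
  · rintro ⟨hi, rfl⟩
    rw [ofReal_integral_eq_lintegral_ofReal hi (.of_forall hf)]
  · intro h
    refine ⟨⟨hm.aestronglyMeasurable, ?_⟩, ?_⟩
    · rw [hasFiniteIntegral_iff_ofReal (.of_forall hf), h]
      exact ENNReal.ofReal_lt_top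
    · rw [integral_eq_lintegral_of_nonneg_ae (.of_forall hf) hm.aestronglyMeasurable, h,
        ENNReal.toReal_ofReal hc]

namespace Scheme

variable {ι : Type*} {I : WeightedSet ι}

theorem unbiased_iff {A : Scheme I} :
    A.Unbiased ↔ ∀ i ∈ I.items, expect A.law (fun o => o.eweight i) = I.eweight i :=
  forall₂_congr fun i _ => integrable_and_integral_eq_iff A.law (fun o => o.weight i)
    (fun o => o.weight_nonneg i) _ (I.weight_nonneg i)

/-- With known means, the covariance is the product moment minus `I.weight i * I.weight j`. A finite
bound on the product moment also gives its integrability. -/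
theorem nonposCov_iff {A : Scheme I} (hA : A.Unbiased) :
    A.NonposCov ↔ ∀ i ∈ I.items, ∀ j ∈ I.items, i ≠ j →
      expect A.law (fun o => o.eweight i * o.eweight j) ≤ I.eweight i * I.eweight j := by
  refine forall₂_congr fun i hi => forall₂_congr fun j hj => forall_congr' fun _ => ?_
  obtain ⟨hi1, hi2⟩ := hA i hi
  obtain ⟨hj1, hj2⟩ := hA j hj
  have hmul : ∀ o : WeightedSet ι,
      o.eweight i * o.eweight j = ENNReal.ofReal (o.weight i * o.weight j) :=
    fun o => (ENNReal.ofReal_mul (o.weight_nonneg i)).symm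
  have h0 : ∀ o : WeightedSet ι, 0 ≤ o.weight i * o.weight j :=
    fun o => mul_nonneg (o.weight_nonneg i) (o.weight_nonneg j)
  simp only [hmul]
  have hcov : Integrable (fun o : WeightedSet ι => o.weight i * o.weight j) A.law.toMeasure →
      cov[fun o => o.weight i, fun o => o.weight j; A.law.toMeasure] =
        ∫ o, o.weight i * o.weight j ∂A.law.toMeasure - I.weight i * I.weight j := by
    intro hij
    simp only [covariance, hi2, hj2]
    have : ∀ o : WeightedSet ι, (o.weight i - I.weight i) * (o.weight j - I.weight j) =
        o.weight i * o.weight j - I.weight j * o.weight i - I.weight i * o.weight j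
          + I.weight i * I.weight j := fun o => by ring
    simp only [this]
    have h1 : Integrable (fun o : WeightedSet ι => o.weight i * o.weight j -
        I.weight j * o.weight i) A.law.toMeasure := hij.sub (hi1.const_mul _)
    have h2 : Integrable (fun o : WeightedSet ι => o.weight i * o.weight j -
        I.weight j * o.weight i - I.weight i * o.weight j) A.law.toMeasure :=
      h1.sub (hj1.const_mul _)
    rw [integral_add h2 (integrable_const _), integral_sub h1 (hj1.const_mul _),
      integral_sub hij (hi1.const_mul _), integral_const_mul, integral_const_mul, hi2, hj2]
    simp
    ring
  constructor
  · rintro ⟨-, -, hij, hc⟩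
    rw [hcov hij] at hc
    rw [(integrable_and_integral_eq_iff A.law _ h0 _ (integral_nonneg h0)).1 ⟨hij, rfl⟩]
    exact ENNReal.ofReal_le_ofReal (by linarith)
  · intro h
    have htop := ne_top_of_le_ne_top ENNReal.ofReal_ne_top h
    obtain ⟨hij, he⟩ := (integrable_and_integral_eq_iff A.law _ h0 _ ENNReal.toReal_nonneg).2
      (ENNReal.ofReal_toReal htop).symm
    refine ⟨hi1, hj1, hij, ?_⟩
    rw [hcov hij, he]
    have := ENNReal.toReal_mono ENNReal.ofReal_ne_top h
    rw [ENNReal.toReal_ofReal (h0 I)] at this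
    linarith

theorem real_eq_toReal_expect (p : PMF (WeightedSet ι)) (s : Set (WeightedSet ι))
    (f : WeightedSet ι → ℝ≥0∞) (h : ∀ o, f o = s.indicator 1 o) :
    p.toMeasure.real s = (expect p f).toReal := by
  rw [← lintegral_toMeasure_eq_expect p (WeightedSet.measurable_of_top _), funext h,
    lintegral_indicator_one MeasurableSpace.measurableSet_top]
  rfl

/-- The probability of sampling all the items of `J`, as an expectation. -/
def incl [DecidableEq ι] (A : Scheme I) (J : Finset ι) : ℝ≥0∞ :=
  expect A.law fun o => ∏ i ∈ J, if i ∈ o.items then 1 else 0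

/-- The probability of sampling none of the items of `J`, as an expectation. -/
def excl [DecidableEq ι] (A : Scheme I) (J : Finset ι) : ℝ≥0∞ :=
  expect A.law fun o => ∏ i ∈ J, if i ∈ o.items then 0 else 1

variable [DecidableEq ι]

theorem incl_le_one (A : Scheme I) (J : Finset ι) : A.incl J ≤ 1 :=
  (expect_le_expect _ fun _ _ => Finset.prod_le_one' fun _ _ => by split_ifs <;> simp).trans_eq
    (expect_const A.law 1)

theorem excl_le_one (A : Scheme I) (J : Finset ι) : A.excl J ≤ 1 :=
  (expect_le_expect _ fun _ _ => Finset.prod_le_one' fun _ _ => by split_ifs <;> simp).trans_eq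
    (expect_const A.law 1)

theorem inclProb_eq (A : Scheme I) (J : Finset ι) : A.inclProb J = (A.incl J).toReal := by
  refine real_eq_toReal_expect _ _ _ fun o => ?_
  by_cases h : J ⊆ o.items
  · rw [Set.indicator_of_mem (by exact h)]
    exact Finset.prod_eq_one fun i hi => if_pos (h hi)
  · rw [Set.indicator_of_notMem (by exact h)]
    obtain ⟨i, hi, hio⟩ := Finset.not_subset.1 h
    exact Finset.prod_eq_zero hi (if_neg hio)

theorem exclProb_eq (A : Scheme I) (J : Finset ι) : A.exclProb J = (A.excl J).toReal := by
  refine real_eq_toReal_expect _ _ _ fun o => ?_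
  by_cases h : Disjoint J o.items
  · rw [Set.indicator_of_mem (by exact h)]
    exact Finset.prod_eq_one fun i hi => if_neg (Finset.disjoint_left.1 h hi)
  · rw [Set.indicator_of_notMem (by exact h)]
    obtain ⟨i, hi, hio⟩ := Finset.not_disjoint_iff.1 h
    exact Finset.prod_eq_zero hi (if_pos hio)

theorem highOrder_iff {A : Scheme I} :
    A.HighOrder ↔ ∀ J ⊆ I.items, A.incl J ≤ ∏ i ∈ J, A.incl {i} ∧
      A.excl J ≤ ∏ i ∈ J, A.excl {i} := by
  refine forall₂_congr fun J _ => ?_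
  simp only [inclProb_eq, exclProb_eq, ← ENNReal.toReal_prod]
  rw [ENNReal.toReal_le_toReal, ENNReal.toReal_le_toReal]
  · exact ne_top_of_le_ne_top ENNReal.one_ne_top (A.excl_le_one J)
  · exact ENNReal.prod_ne_top fun i _ =>
      ne_top_of_le_ne_top ENNReal.one_ne_top (A.excl_le_one _)
  · exact ne_top_of_le_ne_top ENNReal.one_ne_top (A.incl_le_one J)
  · exact ENNReal.prod_ne_top fun i _ =>
      ne_top_of_le_ne_top ENNReal.one_ne_top (A.incl_le_one _)

theorem incl_singleton (A : Scheme I) (i : ι) :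
    A.incl {i} = expect A.law fun o => if i ∈ o.items then 1 else 0 := by
  simp only [incl, Finset.prod_singleton]

theorem excl_singleton (A : Scheme I) (i : ι) :
    A.excl {i} = expect A.law fun o => if i ∈ o.items then 0 else 1 := by
  simp only [excl, Finset.prod_singleton]

theorem incl_add_excl (A : Scheme I) (i : ι) : A.incl {i} + A.excl {i} = 1 := by
  rw [incl_singleton, excl_singleton, ← expect_add]
  exact (expect_congr _ fun o _ => by split_ifs <;> simp).trans (expect_const A.law 1)

theorem inclProb_eq_iff (A : Scheme I) (i : ι) {c : ℝ} (hc : 0 ≤ c) :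
    A.inclProb {i} = c ↔ A.incl {i} = ENNReal.ofReal c := by
  rw [inclProb_eq, ← ENNReal.toReal_eq_toReal_iff'
    (ne_top_of_le_ne_top ENNReal.one_ne_top (A.incl_le_one _)) ENNReal.ofReal_ne_top,
    ENNReal.toReal_ofReal hc]

theorem mem_of_incl_eq_one {A : Scheme I} {i : ι} (h : A.incl {i} = 1) {o : WeightedSet ι}
    (ho : o ∈ A.law.support) : i ∈ o.items := by
  have h' : A.excl {i} = 0 := by
    have := A.incl_add_excl i
    rw [h] at this
    exact (ENNReal.add_right_inj ENNReal.one_ne_top).1 (this.trans (add_zero 1).symm)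
  rw [excl_singleton, expect_eq_zero_iff] at h'
  by_contra hio
  simpa [hio] using h' o ho

end Scheme

/-! ### Composition of schemes -/

namespace Scheme

variable {ι : Type*} {I : WeightedSet ι}

/-- Run `A`, and then, with fresh randomness, the scheme `B` on its outcome. -/
def comp (A : Scheme I) (B : ∀ v : WeightedSet ι, Scheme v) : Scheme I where
  law := A.law.bind fun v => (B v).law
  subset := by
    intro o ho
    obtain ⟨v, hv, hov⟩ := (PMF.mem_support_bind_iff _ _ _).mp ho
    exact ((B v).subset o hov).trans (A.subset v hv)

variable {A : Scheme I} {B : ∀ v : WeightedSet ι, Scheme v}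

theorem expect_comp (f : WeightedSet ι → ℝ≥0∞) :
    expect (A.comp B).law f = expect A.law fun v => expect (B v).law f :=
  expect_bind _ _ _

theorem notMem_of_mem_support {C : Scheme I} {o : WeightedSet ι} (ho : o ∈ C.law.support) {i : ι}
    (hi : i ∉ I.items) : i ∉ o.items := fun h => hi (C.subset o ho h)

theorem expect_eweight_eq_zero (C : Scheme I) {i : ι} (hi : i ∉ I.items) :
    expect C.law (fun o => o.eweight i) = 0 :=
  (expect_eq_zero_iff _ _).2 fun _ ho =>
    WeightedSet.eweight_eq_zero (notMem_of_mem_support ho hi)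

/-- Dropping `i ∈ I.items` matters in a composition, where the first stage may already have lost
`i`; both sides are then `0`. -/
theorem Unbiased.expect_eweight {C : Scheme I} (hC : C.Unbiased) (i : ι) :
    expect C.law (fun o => o.eweight i) = I.eweight i := by
  by_cases hi : i ∈ I.items
  · exact unbiased_iff.1 hC i hi
  · rw [expect_eweight_eq_zero C hi, WeightedSet.eweight_eq_zero hi]

theorem NonposCov.expect_mul_le {C : Scheme I} (hC : C.NonposCov) (hu : C.Unbiased) {i j : ι}
    (hij : i ≠ j) :
    expect C.law (fun o => o.eweight i * o.eweight j) ≤ I.eweight i * I.eweight j := by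
  by_cases hi : i ∈ I.items
  · by_cases hj : j ∈ I.items
    · exact (nonposCov_iff hu).1 hC i hi j hj hij
    · refine ((expect_eq_zero_iff _ _).2 fun o ho => ?_).le.trans zero_le
      rw [WeightedSet.eweight_eq_zero (notMem_of_mem_support ho hj), mul_zero]
  · refine ((expect_eq_zero_iff _ _).2 fun o ho => ?_).le.trans zero_le
    rw [WeightedSet.eweight_eq_zero (notMem_of_mem_support ho hi), zero_mul]

theorem Unbiased.comp (hA : A.Unbiased) (hB : ∀ v ∈ A.law.support, (B v).Unbiased) :
    (A.comp B).Unbiased := by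
  refine unbiased_iff.2 fun i _ => ?_
  rw [expect_comp, expect_congr _ fun v hv => (hB v hv).expect_eweight i, hA.expect_eweight]

/-- Given `v`, the expected product of the final estimates is at most `v.eweight i * v.eweight j`;
the bound for `A` applies to the expectation of this. -/
theorem NonposCov.comp (hAu : A.Unbiased) (hA : A.NonposCov)
    (hBu : ∀ v ∈ A.law.support, (B v).Unbiased) (hB : ∀ v ∈ A.law.support, (B v).NonposCov) :
    (A.comp B).NonposCov := by
  refine (nonposCov_iff (hAu.comp hBu)).2 fun i _ j _ hij => ?_
  rw [expect_comp]
  exact (expect_le_expect _ fun v hv => (hB v hv).expect_mul_le (hBu v hv) hij).trans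
    (hA.expect_mul_le hAu hij)

theorem AtMost.comp {k : ℕ} (hB : ∀ v ∈ A.law.support, (B v).AtMost k) :
    (A.comp B).AtMost k := by
  intro o ho
  obtain ⟨v, hv, hov⟩ := (PMF.mem_support_bind_iff _ _ _).mp ho
  exact hB v hv o hov

variable [DecidableEq ι]

theorem incl_eq_zero (C : Scheme I) {J : Finset ι} (hJ : ¬ J ⊆ I.items) : C.incl J = 0 := by
  obtain ⟨i, hi, hiI⟩ := Finset.not_subset.1 hJ
  exact (expect_eq_zero_iff _ _).2 fun o ho =>
    Finset.prod_eq_zero hi (if_neg (notMem_of_mem_support ho hiI))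

/-- Lets (iii+) of a second-stage scheme on `v` be used for sets `J` that are not contained in
`v.items`. -/
theorem excl_eq_excl_inter (C : Scheme I) (J : Finset ι) : C.excl J = C.excl (J ∩ I.items) := by
  refine expect_congr _ fun o ho => (Finset.prod_subset Finset.inter_subset_left ?_).symm
  intro i hi hi'
  exact if_neg (notMem_of_mem_support ho fun h => hi' (Finset.mem_inter.2 ⟨hi, h⟩))

/-- If the sampling probability of an item in the second stage does not depend on the outcome of
the first stage, then it is multiplied with that of the first stage. -/
theorem incl_singleton_comp {p : ι → ℝ≥0∞}
    (hp : ∀ v ∈ A.law.support, ∀ i ∈ v.items, (B v).incl {i} = p i) (i : ι) :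
    (A.comp B).incl {i} = p i * A.incl {i} := by
  rw [incl, expect_comp, incl_singleton A, ← expect_mul_left]
  refine expect_congr _ fun v hv => ?_
  change (B v).incl {i} = _
  by_cases hi : i ∈ v.items
  · simp [hp v hv i hi, hi]
  · rw [incl_eq_zero _ (by simpa using hi), if_neg hi, mul_zero]

theorem excl_singleton_eq_of_incl_eq (C : Scheme I) {i : ι} {p q : ℝ≥0∞} (h : C.incl {i} = p)
    (hpq : p + q = 1) : C.excl {i} = q := by
  have hp : p ≠ ∞ := by
    rintro rfl
    simp at hpq
  have h' := C.incl_add_excl i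
  rw [h, ← hpq] at h'
  exact (ENNReal.add_right_inj hp).1 h'

/-- The complement of `incl_singleton_comp`. The separate function `q` with `p i + q i = 1` avoids
truncated subtraction in `ℝ≥0∞`. -/
theorem excl_singleton_comp {p q : ι → ℝ≥0∞} (hpq : ∀ i, p i + q i = 1)
    (hp : ∀ v ∈ A.law.support, ∀ i ∈ v.items, (B v).incl {i} = p i) (i : ι) :
    (A.comp B).excl {i} = p i * A.excl {i} + q i := by
  refine excl_singleton_eq_of_incl_eq _ (incl_singleton_comp hp i) ?_
  rw [← add_assoc, ← mul_add, A.incl_add_excl, mul_one, hpq]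

/-- Constancy of `p` makes the second-stage bound depend on `v` only through the set of surviving
items. For inclusion it is `∏ p i` on the event `J ⊆ v.items`. For exclusion it is a polynomial with
nonnegative coefficients in the indicators of `i ∉ v.items`, so the bound for `A` applies to each
monomial. -/
theorem HighOrder.comp {p q : ι → ℝ≥0∞} (hpq : ∀ i, p i + q i = 1)
    (hp : ∀ v ∈ A.law.support, ∀ i ∈ v.items, (B v).incl {i} = p i)
    (hA : A.HighOrder) (hB : ∀ v ∈ A.law.support, (B v).HighOrder) : (A.comp B).HighOrder := by
  refine highOrder_iff.2 fun J hJ => ⟨?_, ?_⟩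
  · simp only [incl_singleton_comp hp, Finset.prod_mul_distrib]
    refine le_trans ?_ (mul_le_mul_right (highOrder_iff.1 hA J hJ).1 _)
    rw [incl, incl, expect_comp, ← expect_mul_left]
    refine expect_le_expect _ fun v hv => ?_
    change (B v).incl J ≤ _
    by_cases h : J ⊆ v.items
    · rw [Finset.prod_eq_one fun i hi => if_pos (h hi), mul_one]
      refine (highOrder_iff.1 (hB v hv) J h).1.trans_eq ?_
      exact Finset.prod_congr rfl fun i hi => hp v hv i (h hi)
    · rw [incl_eq_zero _ h]
      exact zero_le
  · simp only [excl_singleton_comp hpq hp, Finset.prod_add]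
    have key : ∀ v ∈ A.law.support, (B v).excl J ≤ ∑ K ∈ J.powerset,
        ((∏ i ∈ K, p i) * ∏ i ∈ J \ K, q i) * ∏ i ∈ K, if i ∈ v.items then 0 else 1 := by
      intro v hv
      -- A surviving item has the factor `q i`; a lost one has the factor `p i + q i = 1`, so the
      -- product may run over all of `J`.
      have h1 : (B v).excl J ≤ ∏ i ∈ J, (p i * (if i ∈ v.items then 0 else 1) + q i) := by
        rw [excl_eq_excl_inter]
        refine (highOrder_iff.1 (hB v hv) _ Finset.inter_subset_right).2.trans_eq ?_
        have h2 : ∀ i ∈ J ∩ v.items, (B v).excl {i} =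
            p i * (if i ∈ v.items then 0 else 1) + q i := fun i hi => by
          have hi' := (Finset.mem_inter.1 hi).2
          rw [excl_singleton_eq_of_incl_eq _ (hp v hv i hi') (hpq i), if_pos hi', mul_zero,
            zero_add]
        rw [Finset.prod_congr rfl h2]
        refine Finset.prod_subset Finset.inter_subset_left fun i hi hi' => ?_
        rw [if_neg fun h => hi' (Finset.mem_inter.2 ⟨hi, h⟩), mul_one, hpq]
      refine h1.trans_eq ?_
      rw [Finset.prod_add]
      refine Finset.sum_congr rfl fun K _ => ?_
      rw [Finset.prod_mul_distrib]
      ring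
    rw [excl, expect_comp]
    refine (expect_le_expect _ key).trans ?_
    rw [expect_finset_sum]
    refine Finset.sum_le_sum fun K hK => ?_
    rw [expect_mul_left, Finset.prod_mul_distrib, mul_right_comm]
    gcongr
    exact (highOrder_iff.1 hA K ((Finset.mem_powerset.1 hK).trans hJ)).2

end Scheme

/-! ### Independent unions of schemes -/

section Union

variable {ι : Type*} {m : ℕ} {I : Fin m → WeightedSet ι} {inner : ∀ x, Scheme (I x)}

theorem notMem_of_disjoint (hI : Pairwise fun x y => Disjoint (I x).items (I y).items)
    {x y : Fin m} {i : ι} (hi : i ∈ (I x).items) (hxy : y ≠ x) : i ∉ (I y).items :=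
  fun h => Finset.disjoint_left.1 (hI hxy) h hi

theorem subset_of_mem_support_indep {f : Fin m → WeightedSet ι}
    (hf : f ∈ (indep fun x => (inner x).law).support) (x : Fin m) :
    (f x).items ⊆ (I x).items :=
  (inner x).subset _ (mem_support_indep.1 hf x)

variable [DecidableEq ι]

theorem WeightedSet.mem_union {v : Fin m → WeightedSet ι} {i : ι} :
    i ∈ (WeightedSet.union v).items ↔ ∃ x, i ∈ (v x).items := by
  simp [WeightedSet.union]

theorem WeightedSet.union_weight (hI : Pairwise fun x y => Disjoint (I x).items (I y).items)
    {v : Fin m → WeightedSet ι} (hv : ∀ x, (v x).items ⊆ (I x).items)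
    {x : Fin m} {i : ι} (hi : i ∈ (I x).items) : (WeightedSet.union v).weight i = (v x).weight i := by
  change ∑ y, (v y).weight i = _
  exact Finset.sum_eq_single x
    (fun _ _ hy => (v _).weight_eq_zero i fun h => notMem_of_disjoint hI hi hy (hv _ h))
    fun h => absurd (Finset.mem_univ x) h

theorem WeightedSet.mem_union_iff (hI : Pairwise fun x y => Disjoint (I x).items (I y).items)
    {v : Fin m → WeightedSet ι} (hv : ∀ x, (v x).items ⊆ (I x).items)
    {x : Fin m} {i : ι} (hi : i ∈ (I x).items) :
    i ∈ (WeightedSet.union v).items ↔ i ∈ (v x).items := by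
  rw [WeightedSet.mem_union]
  refine ⟨?_, fun h => ⟨x, h⟩⟩
  rintro ⟨y, hy⟩
  by_cases hyx : y = x
  · exact hyx ▸ hy
  · exact absurd (hv y hy) (notMem_of_disjoint hI hi hyx)

theorem mem_support_innerUnion {v : WeightedSet ι} (hv : v ∈ (innerUnion inner).law.support) :
    ∃ f : Fin m → WeightedSet ι, (∀ x, f x ∈ (inner x).law.support) ∧ WeightedSet.union f = v := by
  obtain ⟨f, hf, h⟩ := (PMF.mem_support_map_iff _ _ _).1 hv
  exact ⟨f, mem_support_indep.1 hf, h⟩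

theorem expect_innerUnion (g : WeightedSet ι → ℝ≥0∞) : expect (innerUnion inner).law g =
    expect (indep fun x => (inner x).law) fun f => g (WeightedSet.union f) :=
  expect_map _ _ _

theorem Scheme.Unbiased.innerUnion
    (hI : Pairwise fun x y => Disjoint (I x).items (I y).items)
    (h : ∀ x, (inner x).Unbiased) : (innerUnion inner).Unbiased := by
  refine Scheme.unbiased_iff.2 fun i hi => ?_
  obtain ⟨x, hx⟩ := WeightedSet.mem_union.1 hi
  rw [expect_innerUnion, WeightedSet.eweight,
    WeightedSet.union_weight hI (fun _ => subset_rfl) hx, ← WeightedSet.eweight,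
    ← (h x).expect_eweight, ← expect_indep_eval (fun x => (inner x).law) x]
  refine expect_congr _ fun f hf => ?_
  rw [WeightedSet.eweight, WeightedSet.union_weight hI (subset_of_mem_support_indep hf) hx,
    WeightedSet.eweight]

/-- Within a block the bound is that of the inner call; across blocks independence gives equality.
-/
theorem Scheme.NonposCov.innerUnion
    (hI : Pairwise fun x y => Disjoint (I x).items (I y).items)
    (hu : ∀ x, (inner x).Unbiased) (h : ∀ x, (inner x).NonposCov) :
    (innerUnion inner).NonposCov := by
  refine (Scheme.nonposCov_iff (Scheme.Unbiased.innerUnion hI hu)).2 fun i hi j hj hij => ?_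
  obtain ⟨x, hx⟩ := WeightedSet.mem_union.1 hi
  obtain ⟨y, hy⟩ := WeightedSet.mem_union.1 hj
  have hw : ∀ v : Fin m → WeightedSet ι, (∀ x, (v x).items ⊆ (I x).items) →
      (WeightedSet.union v).eweight i * (WeightedSet.union v).eweight j =
        (v x).eweight i * (v y).eweight j := fun v hv => by
    simp only [WeightedSet.eweight, WeightedSet.union_weight hI hv hx,
      WeightedSet.union_weight hI hv hy]
  rw [expect_innerUnion, hw I fun _ => subset_rfl,
    expect_congr _ fun f hf => hw f (subset_of_mem_support_indep hf)]
  by_cases hxy : x = y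
  · subst hxy
    rw [expect_indep_eval _ x fun o : WeightedSet ι => o.eweight i * o.eweight j]
    exact (h x).expect_mul_le (hu x) hij
  · rw [expect_indep_eval_mul _ hxy (fun o : WeightedSet ι => o.eweight i)
      fun o => o.eweight j, (hu x).expect_eweight, (hu y).expect_eweight]

theorem prod_union_eq_prod_prod {M : Type*} [CommMonoid M]
    (hI : Pairwise fun x y => Disjoint (I x).items (I y).items) {J : Finset ι}
    (hJ : J ⊆ (WeightedSet.union I).items) (g : ι → M) :
    ∏ i ∈ J, g i = ∏ x, ∏ i ∈ J ∩ (I x).items, g i := by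
  rw [← Finset.prod_biUnion]
  · congr 1
    ext i
    simp only [Finset.mem_biUnion, Finset.mem_univ, true_and, Finset.mem_inter]
    refine ⟨fun h => ?_, fun ⟨_, h, _⟩ => h⟩
    obtain ⟨x, hx⟩ := WeightedSet.mem_union.1 (hJ h)
    exact ⟨x, h, hx⟩
  · intro x _ y _ hxy
    exact (hI hxy).mono Finset.inter_subset_right Finset.inter_subset_right

/-- The values `a, b` are `1, 0` for inclusion and `0, 1` for exclusion. -/
theorem expect_innerUnion_prod (hI : Pairwise fun x y => Disjoint (I x).items (I y).items)
    {J : Finset ι} (hJ : J ⊆ (WeightedSet.union I).items) (a b : ℝ≥0∞) :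
    expect (innerUnion inner).law (fun o => ∏ i ∈ J, if i ∈ o.items then a else b) =
      ∏ x, expect (inner x).law
        (fun o => ∏ i ∈ J ∩ (I x).items, if i ∈ o.items then a else b) := by
  rw [expect_innerUnion, ← expect_indep_prod]
  refine expect_congr _ fun f hf => ?_
  rw [prod_union_eq_prod_prod hI hJ]
  refine Finset.prod_congr rfl fun x _ => Finset.prod_congr rfl fun i hi => ?_
  simp only [WeightedSet.mem_union_iff hI (subset_of_mem_support_indep hf)
    (Finset.mem_inter.1 hi).2]

theorem expect_innerUnion_mem (hI : Pairwise fun x y => Disjoint (I x).items (I y).items)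
    {x : Fin m} {i : ι} (hi : i ∈ (I x).items) (a b : ℝ≥0∞) :
    expect (innerUnion inner).law (fun o => if i ∈ o.items then a else b) =
      expect (inner x).law (fun o => if i ∈ o.items then a else b) := by
  rw [expect_innerUnion, ← expect_indep_eval (fun x => (inner x).law) x]
  refine expect_congr _ fun f hf => ?_
  simp only [WeightedSet.mem_union_iff hI (subset_of_mem_support_indep hf) hi]

theorem incl_singleton_innerUnion (hI : Pairwise fun x y => Disjoint (I x).items (I y).items)
    {x : Fin m} {i : ι} (hi : i ∈ (I x).items) :
    (innerUnion inner).incl {i} = (inner x).incl {i} := by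
  simpa only [Scheme.incl_singleton] using expect_innerUnion_mem hI hi 1 0

theorem excl_singleton_innerUnion (hI : Pairwise fun x y => Disjoint (I x).items (I y).items)
    {x : Fin m} {i : ι} (hi : i ∈ (I x).items) :
    (innerUnion inner).excl {i} = (inner x).excl {i} := by
  simpa only [Scheme.excl_singleton] using expect_innerUnion_mem hI hi 0 1

theorem Scheme.HighOrder.innerUnion (hI : Pairwise fun x y => Disjoint (I x).items (I y).items)
    (h : ∀ x, (inner x).HighOrder) : (innerUnion inner).HighOrder := by
  refine Scheme.highOrder_iff.2 fun J hJ => ⟨?_, ?_⟩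
  · rw [Scheme.incl, expect_innerUnion_prod hI hJ, prod_union_eq_prod_prod hI hJ]
    refine Finset.prod_le_prod' fun x _ => ?_
    rw [Finset.prod_congr rfl fun i hi =>
      incl_singleton_innerUnion hI (Finset.mem_inter.1 hi).2]
    exact (Scheme.highOrder_iff.1 (h x) _ Finset.inter_subset_right).1
  · rw [Scheme.excl, expect_innerUnion_prod hI hJ, prod_union_eq_prod_prod hI hJ]
    refine Finset.prod_le_prod' fun x _ => ?_
    rw [Finset.prod_congr rfl fun i hi =>
      excl_singleton_innerUnion hI (Finset.mem_inter.1 hi).2]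
    exact (Scheme.highOrder_iff.1 (h x) _ Finset.inter_subset_right).2

end Union

/-! ### Thresholds -/

section Threshold

variable {ι : Type*}

/-- The sum whose value at the threshold for `k` is `k`. -/
def WeightedSet.thresholdSum (I : WeightedSet ι) (τ : ℝ) : ℝ :=
  ∑ i ∈ I.items, min 1 (I.weight i / τ)

theorem WeightedSet.thresholdSum_nonneg (I : WeightedSet ι) {τ : ℝ} (hτ : 0 < τ) :
    0 ≤ I.thresholdSum τ :=
  Finset.sum_nonneg fun i _ => le_min zero_le_one (div_nonneg (I.weight_nonneg i) hτ.le)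

theorem IsThreshold.nonneg {k : ℕ} {I : WeightedSet ι} {τ : ℝ} (h : IsThreshold k I τ) :
    0 ≤ τ := by
  obtain ⟨-, h, -⟩ | ⟨-, h⟩ := h
  exacts [h.le, h.ge]

theorem thresholdProb_nonneg {w τ : ℝ} (hw : 0 ≤ w) (hτ : 0 ≤ τ) : 0 ≤ thresholdProb w τ := by
  unfold thresholdProb
  split_ifs
  exacts [zero_le_one, le_min zero_le_one (div_nonneg hw hτ)]

theorem thresholdProb_le_one (w τ : ℝ) : thresholdProb w τ ≤ 1 := by
  unfold thresholdProb
  split_ifs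
  exacts [le_rfl, min_le_left _ _]

/-- Intermediate value theorem: at the least weight every summand is `1`, so the sum is the number
of items, while at `(∑ w) / k` or above it is at most `k`. -/
theorem exists_isThreshold {k : ℕ} (hk : 1 ≤ k) (I : WeightedSet ι) :
    ∃ τ, IsThreshold k I τ := by
  by_cases hcard : I.items.card ≤ k
  · exact ⟨0, .inr ⟨hcard, rfl⟩⟩
  push Not at hcard
  have hne : I.items.Nonempty := Finset.card_pos.1 (by omega)
  have hk0 : (0 : ℝ) < k := by exact_mod_cast hk
  obtain ⟨i₀, hi₀, hmin⟩ := I.items.exists_min_image I.weight hne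
  set a := I.weight i₀
  have ha : 0 < a := I.weight_pos i₀ hi₀
  -- The maximum with `a` ensures that the interval is nonempty.
  set b := max a ((∑ i ∈ I.items, I.weight i) / k)
  have hb : 0 < b := ha.trans_le (le_max_left _ _)
  have hcont : ContinuousOn I.thresholdSum (Set.Icc a b) := by
    refine continuousOn_finsetSum _ fun i _ => ?_
    refine ContinuousOn.inf continuousOn_const (continuousOn_const.div continuousOn_id fun τ hτ => ?_)
    exact (ha.trans_le hτ.1).ne'
  have hfa : (k : ℝ) ≤ I.thresholdSum a := by
    have : I.thresholdSum a = ∑ _i ∈ I.items, (1 : ℝ) :=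
      Finset.sum_congr rfl fun i hi => min_eq_left ((one_le_div ha).2 (hmin i hi))
    rw [this]
    simpa using hcard.le
  have hfb : I.thresholdSum b ≤ k := by
    refine (Finset.sum_le_sum fun i _ => min_le_right _ _).trans ?_
    rw [← Finset.sum_div, div_le_iff₀ hb, ← div_le_iff₀' hk0]
    exact le_max_right _ _
  obtain ⟨τ, hτ, h⟩ := intermediate_value_Icc' (le_max_left a _) hcont ⟨hfb, hfa⟩
  exact ⟨τ, .inl ⟨hcard, ha.trans_le hτ.1, h⟩⟩

/-- The threshold sum is antitone on positive arguments. Where it is below the number of items, some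
summand is below `1`, and this one strictly increases when the argument decreases. -/
theorem WeightedSet.le_of_thresholdSum_le {I : WeightedSet ι} {σ τ : ℝ} (hτ : 0 < τ)
    (hcard : I.thresholdSum σ < I.items.card) (h : I.thresholdSum τ ≤ I.thresholdSum σ) :
    σ ≤ τ := by
  by_contra! hlt
  have hσ : 0 < σ := hτ.trans hlt
  have hle : ∀ i, min 1 (I.weight i / σ) ≤ min 1 (I.weight i / τ) := fun i =>
    min_le_min le_rfl (div_le_div_of_nonneg_left (I.weight_nonneg i) hτ hlt.le)
  have hex : ∃ i ∈ I.items, min 1 (I.weight i / σ) < 1 := by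
    by_contra! hall
    have := Finset.card_nsmul_le_sum I.items _ 1 hall
    rw [nsmul_eq_mul, mul_one] at this
    exact absurd this (not_le.2 hcard)
  obtain ⟨i, hi, hi1⟩ := hex
  have hlt' : min 1 (I.weight i / σ) < min 1 (I.weight i / τ) := by
    have hs : I.weight i / σ < 1 := by simpa using hi1
    rw [min_eq_right hs.le]
    exact lt_min hs (div_lt_div_of_pos_left (I.weight_pos i hi) hτ hlt)
  exact absurd h (not_le.2 (Finset.sum_lt_sum (fun i _ => hle i) ⟨i, hi, hlt'⟩))

theorem IsThreshold.le_of_thresholdSum_le {k : ℕ} {I : WeightedSet ι} {σ τ : ℝ}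
    (hσ : IsThreshold k I σ) (hτ : 0 < τ) (h : I.thresholdSum τ ≤ k) : σ ≤ τ := by
  obtain ⟨hcard, -, hs⟩ | ⟨-, rfl⟩ := hσ
  · change I.thresholdSum σ = k at hs
    exact WeightedSet.le_of_thresholdSum_le hτ (by rw [hs]; exact_mod_cast hcard) (by rwa [hs])
  · exact hτ.le

theorem IsThreshold.eq_of_thresholdSum_eq {k : ℕ} {I : WeightedSet ι} {σ τ : ℝ}
    (hσ : IsThreshold k I σ) (hcard : k < I.items.card) (hτ : 0 < τ) (h : I.thresholdSum τ = k) :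
    σ = τ := by
  refine le_antisymm (hσ.le_of_thresholdSum_le hτ h.le) ?_
  obtain ⟨-, hσ0, hs⟩ | ⟨h', -⟩ := hσ
  · exact IsThreshold.le_of_thresholdSum_le (.inl ⟨hcard, hτ, h⟩) hσ0 hs.le
  · omega

end Threshold

/-! ### Threshold sampling -/

namespace Scheme

variable {ι : Type*} {I : WeightedSet ι}

/-- Property (i) with an explicit threshold. -/
structure IppsAt (k : ℕ) (τ : ℝ) (A : Scheme I) : Prop where
  isThreshold : IsThreshold k I τ
  inclProb : ∀ i ∈ I.items, A.inclProb {i} = thresholdProb (I.weight i) τ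
  weight : ∀ o ∈ A.law.support, ∀ i ∈ o.items, o.weight i = max (I.weight i) τ

theorem ipps_iff {k : ℕ} {A : Scheme I} : A.Ipps k ↔ ∃ τ, A.IppsAt k τ :=
  ⟨fun ⟨τ, h1, h2, h3⟩ => ⟨τ, h1, h2, h3⟩, fun ⟨τ, h1, h2, h3⟩ => ⟨τ, h1, h2, h3⟩⟩

variable {k : ℕ} {τ : ℝ} {A : Scheme I}

/-- A threshold scheme for `k` behaves as if its threshold was `τ` whenever the threshold sum at
`τ` is `k`. This includes the case of exactly `k` items, all of weight at least `τ`. -/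
theorem Ipps.of_thresholdSum_eq (hA : A.Ipps k) (hτ : 0 < τ) (h : I.thresholdSum τ = k) :
    (∀ i ∈ I.items, A.inclProb {i} = thresholdProb (I.weight i) τ) ∧
      ∀ o ∈ A.law.support, ∀ i ∈ o.items, o.weight i = max (I.weight i) τ := by
  obtain ⟨σ, hσ⟩ := ipps_iff.1 hA
  by_cases hcard : k < I.items.card
  · obtain rfl := hσ.isThreshold.eq_of_thresholdSum_eq hcard hτ h
    exact ⟨hσ.inclProb, hσ.weight⟩
  · obtain ⟨h', -⟩ | ⟨-, rfl⟩ := hσ.isThreshold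
    · exact absurd h' hcard
    have hle : (I.items.card : ℝ) ≤ k := by exact_mod_cast not_lt.1 hcard
    -- At most `k` summands, each at most `1`, add up to `k`, so all of them equal `1`.
    have hall : ∀ i ∈ I.items, τ ≤ I.weight i := by
      have hs : ∑ i ∈ I.items, min 1 (I.weight i / τ) = ∑ _i ∈ I.items, (1 : ℝ) := by
        refine le_antisymm (Finset.sum_le_sum fun i _ => min_le_left _ _) ?_
        change _ ≤ I.thresholdSum τ
        simpa [h] using hle
      intro i hi
      have := (Finset.sum_eq_sum_iff_of_le fun i _ => min_le_left _ _).1 hs i hi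
      exact (one_le_div hτ).1 (min_eq_left_iff.1 this)
    refine ⟨fun i hi => ?_, fun o ho i hi => ?_⟩
    · rw [hσ.inclProb i hi, thresholdProb, thresholdProb, if_pos rfl, if_neg hτ.ne',
        min_eq_left ((one_le_div hτ).2 (hall i hi))]
    · rw [hσ.weight o ho i hi, max_eq_left (I.weight_nonneg i),
        max_eq_left (hall i (A.subset o ho hi))]

theorem IppsAt.mem_of_thresholdProb_eq_one (hA : A.IppsAt k τ) {i : ι} (hi : i ∈ I.items)
    (h : thresholdProb (I.weight i) τ = 1) {o : WeightedSet ι} (ho : o ∈ A.law.support) :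
    i ∈ o.items := by
  classical
  refine mem_of_incl_eq_one ?_ ho
  rw [(A.inclProb_eq_iff i zero_le_one).1 ((hA.inclProb i hi).trans h), ENNReal.ofReal_one]

theorem IppsAt.eq_of_mem_support (hA : A.IppsAt k 0) {o : WeightedSet ι}
    (ho : o ∈ A.law.support) : o = I := by
  have h : o.items = I.items := (A.subset o ho).antisymm fun i hi =>
    hA.mem_of_thresholdProb_eq_one hi (if_pos rfl) ho
  refine WeightedSet.ext h (funext fun i => ?_)
  by_cases hi : i ∈ o.items
  · rw [hA.weight o ho i hi, max_eq_left (I.weight_nonneg i)]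
  · rw [o.weight_eq_zero i hi, I.weight_eq_zero i (h ▸ hi)]

/-- The expected sample size is the sum of the inclusion probabilities, which is `k`. A size that
never exceeds its mean equals it on the whole support. -/
theorem IppsAt.card_eq (hA : A.IppsAt k τ) (hk : A.AtMost k) (hcard : k < I.items.card)
    {o : WeightedSet ι} (ho : o ∈ A.law.support) : o.items.card = k := by
  classical
  obtain ⟨-, hτ, hsum⟩ | ⟨h, -⟩ := hA.isThreshold
  swap
  · omega
  have hE : expect A.law (fun o => (o.items.card : ℝ≥0∞)) = k := by
    have h1 : ∀ o ∈ A.law.support,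
        (o.items.card : ℝ≥0∞) = ∑ i ∈ I.items, if i ∈ o.items then 1 else 0 := by
      intro o ho
      rw [Finset.sum_boole, Finset.filter_mem_eq_inter, Finset.inter_eq_right.2 (A.subset o ho)]
    have h0 : ∀ i, 0 ≤ thresholdProb (I.weight i) τ := fun i =>
      thresholdProb_nonneg (I.weight_nonneg i) hτ.le
    rw [expect_congr _ h1, expect_finset_sum]
    rw [Finset.sum_congr rfl fun i hi => (A.incl_singleton i).symm.trans
      ((A.inclProb_eq_iff i (h0 i)).1 (hA.inclProb i hi)),
      ← ENNReal.ofReal_sum_of_nonneg fun i _ => h0 i, ← ENNReal.ofReal_natCast, ← hsum]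
    simp only [thresholdProb, if_neg hτ.ne']
  -- The natural subtraction is exact on the support by `hk`.
  have hE' : expect A.law (fun o => ((k - o.items.card : ℕ) : ℝ≥0∞)) = 0 := by
    refine (ENNReal.add_right_inj (ENNReal.natCast_ne_top k)).1 ?_
    nth_rw 1 [← hE]
    rw [← expect_add, add_zero]
    refine (expect_congr _ fun o ho => ?_).trans (expect_const A.law (k : ℝ≥0∞))
    rw [← Nat.cast_add]
    have := hk o ho
    congr 1
    omega
  have h := (expect_eq_zero_iff _ _).1 hE' o ho
  have := hk o ho
  have h' : k - o.items.card = 0 := by exact_mod_cast h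
  omega

/-- Threshold sampling preserves the threshold sums at all values above the threshold. -/
theorem IppsAt.thresholdSum_eq {σ : ℝ} (hA : A.IppsAt k σ) (hk : A.AtMost k) (hτ : 0 < τ)
    (hστ : σ ≤ τ) {o : WeightedSet ι} (ho : o ∈ A.law.support) :
    o.thresholdSum τ = I.thresholdSum τ := by
  classical
  obtain ⟨hcard, hσ, hsum⟩ | ⟨-, rfl⟩ := hA.isThreshold
  swap
  · rw [hA.eq_of_mem_support ho]
  have hsub := A.subset o ho
  -- Raising weights to at least `σ` adds the last term to each summand. These terms sum to `σ / τ`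
  -- times `I.items.card - k`, which is exactly the contribution of the dropped items: there are
  -- `I.items.card - k` of them, each contributing `σ / τ` by `hout`.
  have hI : ∀ i ∈ I.items, min 1 (I.weight i / τ) =
      min 1 (max (I.weight i) σ / τ) - σ / τ * (1 - min 1 (I.weight i / σ)) := by
    intro i _
    rcases le_total σ (I.weight i) with h | h
    · rw [max_eq_left h, min_eq_left ((one_le_div hσ).2 h)]
      ring
    · rw [max_eq_right h, min_eq_right ((div_le_one hσ).2 h),
        min_eq_right ((div_le_one hτ).2 hστ), min_eq_right ((div_le_one hτ).2 (h.trans hστ))]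
      field_simp
      ring
  have hout : ∀ i ∈ I.items \ o.items, min 1 (max (I.weight i) σ / τ) = σ / τ := by
    intro i hi
    obtain ⟨hiI, hio⟩ := Finset.mem_sdiff.1 hi
    have h : I.weight i ≤ σ := by
      by_contra! h
      refine hio (hA.mem_of_thresholdProb_eq_one hiI ?_ ho)
      rw [thresholdProb, if_neg hσ.ne', min_eq_left ((one_le_div hσ).2 h.le)]
    rw [max_eq_right h, min_eq_right ((div_le_one hτ).2 hστ)]
  have h1 : o.thresholdSum τ = ∑ i ∈ o.items, min 1 (max (I.weight i) σ / τ) :=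
    Finset.sum_congr rfl fun i hi => by rw [hA.weight o ho i hi]
  have h2 := Finset.sum_sdiff hsub (f := fun i => min 1 (max (I.weight i) σ / τ))
  rw [Finset.sum_congr rfl hout, Finset.sum_const, Finset.card_sdiff_of_subset hsub,
    hA.card_eq hk hcard ho, nsmul_eq_mul, Nat.cast_sub hcard.le] at h2
  rw [h1, WeightedSet.thresholdSum, Finset.sum_congr rfl hI, Finset.sum_sub_distrib,
    ← Finset.mul_sum, Finset.sum_sub_distrib, hsum, ← h2]
  simp
  ring

end Scheme

/-! ### Threshold sampling in two stages -/

section Recurrence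

variable {ι : Type*} [DecidableEq ι] {m : ℕ} {I : Fin m → WeightedSet ι}
  {inner : ∀ x, Scheme (I x)}

theorem WeightedSet.thresholdSum_union
    (hI : Pairwise fun x y => Disjoint (I x).items (I y).items)
    {v : Fin m → WeightedSet ι} (hv : ∀ x, (v x).items ⊆ (I x).items) (τ : ℝ) :
    (WeightedSet.union v).thresholdSum τ = ∑ x, (v x).thresholdSum τ := by
  rw [thresholdSum, union, Finset.sum_biUnion fun x _ y _ hxy => (hI hxy).mono (hv x) (hv y)]
  refine Finset.sum_congr rfl fun x _ => Finset.sum_congr rfl fun i hi => ?_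
  rw [← union_weight hI hv (hv x hi)]
  rfl

theorem thresholdProb_mul_thresholdProb_max {w σ τ : ℝ} (hw : 0 ≤ w) (hσ : 0 ≤ σ) (hτ : 0 < τ)
    (hστ : σ ≤ τ) : thresholdProb (max w σ) τ * thresholdProb w σ = thresholdProb w τ := by
  rcases hσ.eq_or_lt with rfl | hσ
  · simp [thresholdProb, max_eq_left hw]
  simp only [thresholdProb, if_neg hτ.ne', if_neg hσ.ne']
  rcases le_total σ w with h | h
  · rw [max_eq_left h, min_eq_left ((one_le_div hσ).2 h), mul_one]
  · rw [max_eq_right h, min_eq_right ((div_le_one hσ).2 h),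
      min_eq_right ((div_le_one hτ).2 hστ), min_eq_right ((div_le_one hτ).2 (h.trans hστ))]
    field_simp

/-- In two-stage threshold sampling the second stage behaves like threshold sampling with the
threshold of the whole input, whatever the outcome of the first stage. -/
theorem exists_threshold_twoStage (hI : Pairwise fun x y => Disjoint (I x).items (I y).items)
    {k : ℕ} (hk : 1 ≤ k) {kx : Fin m → ℕ} (hkx : ∀ x, k ≤ kx x)
    (hinner : ∀ x, (inner x).Ipps (kx x)) (hmost : ∀ x, (inner x).AtMost (kx x)) :
    ∃ τ, IsThreshold k (WeightedSet.union I) τ ∧ ∃ p : ι → ℝ,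
      (∀ i, 0 ≤ p i ∧ p i ≤ 1) ∧
      (∀ i ∈ (WeightedSet.union I).items, p i * (innerUnion inner).inclProb {i} =
        thresholdProb ((WeightedSet.union I).weight i) τ) ∧
      ∀ v ∈ (innerUnion inner).law.support, ∀ C : Scheme v, C.Ipps k →
        (∀ i ∈ v.items, C.inclProb {i} = p i) ∧
        ∀ o ∈ C.law.support, ∀ i ∈ o.items,
          o.weight i = max ((WeightedSet.union I).weight i) τ := by
  set U := WeightedSet.union I
  choose σ hσ using fun x => Scheme.ipps_iff.1 (hinner x)
  have hIU : ∀ x, (I x).items ⊆ U.items := fun x i hi => WeightedSet.mem_union.2 ⟨x, hi⟩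
  have hUw : ∀ {x i}, i ∈ (I x).items → U.weight i = (I x).weight i := fun hi =>
    WeightedSet.union_weight hI (fun _ => subset_rfl) hi
  have hincl : ∀ {x i}, i ∈ (I x).items →
      (innerUnion inner).inclProb {i} = thresholdProb ((I x).weight i) (σ x) := fun {x i} hi => by
    rw [Scheme.inclProb_eq, incl_singleton_innerUnion hI hi, ← Scheme.inclProb_eq,
      (hσ x).inclProb i hi]
  obtain ⟨τ, hτ⟩ := exists_isThreshold hk U
  refine ⟨τ, hτ, ?_⟩
  rcases id hτ with ⟨hcard, hτ0, hsum⟩ | ⟨hcard, rfl⟩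
  · change U.thresholdSum τ = k at hsum
    -- At `τ` the blocks' nonnegative sums add up to `k`, so each is at most `k ≤ kx x`.
    have hστ : ∀ x, σ x ≤ τ := fun x => by
      refine (hσ x).isThreshold.le_of_thresholdSum_le hτ0 ?_
      have hle : (I x).thresholdSum τ ≤ k := by
        rw [← hsum, WeightedSet.thresholdSum_union hI fun _ => subset_rfl]
        exact Finset.single_le_sum (f := fun x => (I x).thresholdSum τ)
          (fun y _ => (I y).thresholdSum_nonneg hτ0) (Finset.mem_univ x)
      exact hle.trans (by exact_mod_cast hkx x)
    have hc : ∀ i, ∃ c : ℝ, 0 ≤ c ∧ ∀ x, i ∈ (I x).items → c = max ((I x).weight i) (σ x) := by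
      intro i
      by_cases h : ∃ x, i ∈ (I x).items
      · obtain ⟨x, hx⟩ := h
        refine ⟨max ((I x).weight i) (σ x), le_max_of_le_left ((I x).weight_nonneg i), ?_⟩
        intro y hy
        by_cases hyx : y = x
        · rw [hyx]
        · exact absurd hy (notMem_of_disjoint hI hx hyx)
      · exact ⟨0, le_rfl, fun x hx => absurd ⟨x, hx⟩ h⟩
    choose c hc0 hc using hc
    refine ⟨fun i => thresholdProb (c i) τ, fun i => ⟨thresholdProb_nonneg (hc0 i) hτ0.le,
      thresholdProb_le_one _ _⟩, fun i hi => ?_, fun v hv C hC => ?_⟩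
    · obtain ⟨x, hx⟩ := WeightedSet.mem_union.1 hi
      change thresholdProb (c i) τ * _ = thresholdProb (U.weight i) τ
      rw [hincl hx, hc i x hx, hUw hx, thresholdProb_mul_thresholdProb_max
        ((I x).weight_nonneg i) (hσ x).isThreshold.nonneg hτ0 (hστ x)]
    · obtain ⟨f, hf, rfl⟩ := mem_support_innerUnion hv
      have hsub : ∀ x, (f x).items ⊆ (I x).items := fun x => (inner x).subset _ (hf x)
      have hw : ∀ i ∈ (WeightedSet.union f).items, (WeightedSet.union f).weight i = c i ∧
          max (c i) τ = max (U.weight i) τ := fun i hi => by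
        obtain ⟨x, hx⟩ := WeightedSet.mem_union.1 hi
        have hx' := hsub x hx
        rw [WeightedSet.union_weight hI hsub hx', hc i x hx', hUw hx', max_assoc,
          max_eq_right (hστ x)]
        exact ⟨(hσ x).weight _ (hf x) i hx, rfl⟩
      have hsum' : (WeightedSet.union f).thresholdSum τ = k := by
        rw [WeightedSet.thresholdSum_union hI hsub, ← hsum,
          WeightedSet.thresholdSum_union hI fun _ => subset_rfl]
        exact Finset.sum_congr rfl fun x _ =>
          (hσ x).thresholdSum_eq (hmost x) hτ0 (hστ x) (hf x)
      -- The threshold of `WeightedSet.union f` itself need not be `τ`: it is `0` if exactly `k`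
      -- items survive. The probabilities and estimates agree all the same.
      obtain ⟨h1, h2⟩ := hC.of_thresholdSum_eq hτ0 hsum'
      refine ⟨fun i hi => ?_, fun o ho i hi => ?_⟩
      · rw [h1 i hi, (hw i hi).1]
      · have hi' := C.subset o ho hi
        rw [h2 o ho i hi, (hw i hi').1, (hw i hi').2]
  -- With at most `k` items in total, no block exceeds its capacity, so every inner call returns its
  -- input unchanged.
  · have hσ0 : ∀ x, σ x = 0 := fun x => by
      rcases (hσ x).isThreshold with ⟨h, -⟩ | ⟨-, h⟩
      · have := Finset.card_le_card (hIU x)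
        have := hkx x
        omega
      · exact h
    refine ⟨fun _ => 1, fun _ => ⟨zero_le_one, le_rfl⟩, fun i hi => ?_, fun v hv C hC => ?_⟩
    · obtain ⟨x, hx⟩ := WeightedSet.mem_union.1 hi
      rw [hincl hx, hσ0, one_mul, thresholdProb, thresholdProb, if_pos rfl, if_pos rfl]
    · obtain ⟨f, hf, rfl⟩ := mem_support_innerUnion hv
      obtain rfl : f = I := funext fun x =>
        Scheme.IppsAt.eq_of_mem_support (hσ0 x ▸ hσ x) (hf x)
      obtain ⟨ρ, hρ⟩ := Scheme.ipps_iff.1 hC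
      obtain ⟨h, -⟩ | ⟨-, rfl⟩ := hρ.isThreshold
      · exact absurd h (not_lt.2 hcard)
      · exact ⟨fun i hi => (hρ.inclProb i hi).trans (if_pos rfl), hρ.weight⟩

theorem resulting_eq_comp (inner : ∀ x, Scheme (I x)) (outer : ∀ v : WeightedSet ι, Scheme v) :
    resulting inner outer = (innerUnion inner).comp outer := rfl

variable {outer : ∀ v : WeightedSet ι, Scheme v}

theorem Scheme.Ipps.resulting (hI : Pairwise fun x y => Disjoint (I x).items (I y).items)
    {k : ℕ} (hk : 1 ≤ k) {kx : Fin m → ℕ} (hkx : ∀ x, k ≤ kx x)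
    (hinner : ∀ x, (inner x).Ipps (kx x)) (hmost : ∀ x, (inner x).AtMost (kx x))
    (houter : ∀ v ∈ (innerUnion inner).law.support, (outer v).Ipps k) :
    (resulting inner outer).Ipps k := by
  obtain ⟨τ, hτ, p, hp, hpU, hpv⟩ := exists_threshold_twoStage hI hk hkx hinner hmost
  refine ⟨τ, hτ, fun i hi => ?_, fun o ho i hi => ?_⟩
  · rw [← hpU i hi, resulting_eq_comp, inclProb_eq, inclProb_eq,
      incl_singleton_comp (p := fun i => ENNReal.ofReal (p i)) fun v hv i hi =>
        ((outer v).inclProb_eq_iff i (hp i).1).1 ((hpv v hv _ (houter v hv)).1 i hi),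
      ENNReal.toReal_mul, ENNReal.toReal_ofReal (hp i).1]
  · obtain ⟨v, hv, hov⟩ := (PMF.mem_support_bind_iff _ _ _).mp ho
    exact (hpv v hv _ (houter v hv)).2 o hov i hi

theorem Scheme.HighOrder.resulting (hI : Pairwise fun x y => Disjoint (I x).items (I y).items)
    {k : ℕ} (hk : 1 ≤ k) {kx : Fin m → ℕ} (hkx : ∀ x, k ≤ kx x)
    (hinner : ∀ x, (inner x).Ipps (kx x)) (hmost : ∀ x, (inner x).AtMost (kx x))
    (houter : ∀ v ∈ (VarOpt.innerUnion inner).law.support, (outer v).Ipps k)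
    (hinner' : ∀ x, (inner x).HighOrder)
    (houter' : ∀ v ∈ (VarOpt.innerUnion inner).law.support, (outer v).HighOrder) :
    (resulting inner outer).HighOrder := by
  obtain ⟨τ, -, p, hp, -, hpv⟩ := exists_threshold_twoStage hI hk hkx hinner hmost
  rw [resulting_eq_comp]
  refine HighOrder.comp (p := fun i => ENNReal.ofReal (p i))
    (q := fun i => ENNReal.ofReal (1 - p i)) (fun i => ?_) (fun v hv i hi => ?_)
    (HighOrder.innerUnion hI hinner') houter'
  · rw [← ENNReal.ofReal_add (hp i).1 (sub_nonneg.2 (hp i).2), add_sub_cancel,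
      ENNReal.ofReal_one]
  · exact ((outer v).inclProb_eq_iff i (hp i).1).1 ((hpv v hv _ (houter v hv)).1 i hi)

theorem Scheme.IsVarOpt.resulting (hI : Pairwise fun x y => Disjoint (I x).items (I y).items)
    {k : ℕ} (hk : 1 ≤ k) {kx : Fin m → ℕ} (hkx : ∀ x, k ≤ kx x)
    (hinner : ∀ x, (inner x).IsVarOpt (kx x))
    (houter : ∀ v ∈ (innerUnion inner).law.support, (outer v).IsVarOpt k) :
    (resulting inner outer).IsVarOpt k where
  unbiased := (Unbiased.innerUnion hI fun x => (hinner x).unbiased).comp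
    fun v hv => (houter v hv).unbiased
  ipps := Ipps.resulting hI hk hkx (fun x => (hinner x).ipps) (fun x => (hinner x).atMost)
    fun v hv => (houter v hv).ipps
  atMost := AtMost.comp fun v hv => (houter v hv).atMost
  nonposCov := NonposCov.comp (Unbiased.innerUnion hI fun x => (hinner x).unbiased)
    (NonposCov.innerUnion hI (fun x => (hinner x).unbiased) fun x => (hinner x).nonposCov)
    (fun v hv => (houter v hv).unbiased) fun v hv => (houter v hv).nonposCov

end Recurrence

end VarOpt

end

/-- The recurrence `VarOpt_k (⋃ I_x) = VarOpt_k (⋃ VarOpt_{k_x} (I_x))`. The outer scheme is only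
required to have the respective properties on the inputs that the inner calls can produce. -/
theorem mainTheorem1 {ι : Type*} [DecidableEq ι] {m : ℕ} (I : Fin m → VarOpt.WeightedSet ι)
    (hI : Pairwise fun x y => Disjoint (I x).items (I y).items)
    (k : ℕ) (hk : 1 ≤ k) (kx : Fin m → ℕ) (hkx : ∀ x, k ≤ kx x)
    (inner : ∀ x, VarOpt.Scheme (I x)) (outer : ∀ v : VarOpt.WeightedSet ι, VarOpt.Scheme v) :
    -- unbiasedness is preserved
    ((∀ x, (inner x).Unbiased) →
      (∀ v ∈ (VarOpt.innerUnion inner).law.support, (outer v).Unbiased) →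
      (VarOpt.resulting inner outer).Unbiased) ∧
    -- (iii) is preserved by unbiased schemes
    ((∀ x, (inner x).Unbiased ∧ (inner x).NonposCov) →
      (∀ v ∈ (VarOpt.innerUnion inner).law.support, (outer v).Unbiased ∧ (outer v).NonposCov) →
      (VarOpt.resulting inner outer).NonposCov) ∧
    -- (i) and (ii) for the inner calls and (i) for the outer call give (i)
    ((∀ x, (inner x).Ipps (kx x) ∧ (inner x).AtMost (kx x)) →
      (∀ v ∈ (VarOpt.innerUnion inner).law.support, (outer v).Ipps k) →
      (VarOpt.resulting inner outer).Ipps k) ∧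
    -- unbiasedness with (i)-(iii) is preserved
    ((∀ x, (inner x).IsVarOpt (kx x)) →
      (∀ v ∈ (VarOpt.innerUnion inner).law.support, (outer v).IsVarOpt k) →
      (VarOpt.resulting inner outer).IsVarOpt k) ∧
    -- unbiasedness with (i)-(iii) and (iii+) is preserved
    ((∀ x, (inner x).IsVarOptPlus (kx x)) →
      (∀ v ∈ (VarOpt.innerUnion inner).law.support, (outer v).IsVarOptPlus k) →
      (VarOpt.resulting inner outer).IsVarOptPlus k) := by
  refine ⟨fun hin hout => ?_, fun hin hout => ?_, fun hin hout => ?_, fun hin hout => ?_,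
    fun hin hout => ?_⟩
  · exact (VarOpt.Scheme.Unbiased.innerUnion hI hin).comp hout
  · exact VarOpt.Scheme.NonposCov.comp
      (VarOpt.Scheme.Unbiased.innerUnion hI fun x => (hin x).1)
      (VarOpt.Scheme.NonposCov.innerUnion hI (fun x => (hin x).1) fun x => (hin x).2)
      (fun v hv => (hout v hv).1) fun v hv => (hout v hv).2
  · exact VarOpt.Scheme.Ipps.resulting hI hk hkx (fun x => (hin x).1) (fun x => (hin x).2) hout
  · exact VarOpt.Scheme.IsVarOpt.resulting hI hk hkx hin hout
  · exact {
      VarOpt.Scheme.IsVarOpt.resulting hI hk hkx (fun x => (hin x).toIsVarOpt)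
        fun v hv => (hout v hv).toIsVarOpt with
      highOrder := VarOpt.Scheme.HighOrder.resulting hI hk hkx (fun x => (hin x).ipps)
        (fun x => (hin x).atMost) (fun v hv => (hout v hv).ipps)
        (fun x => (hin x).highOrder) fun v hv => (hout v hv).highOrder }
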